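/- **Setting.** One-shot devices are tested under $I$ conditions. Condition $i\in\{1,\dots,I\}$ has a covariate vector $\boldsymbol x_i=(x_{i0},\dots,x_{iJ})^T\in\mathbb R^{J+1}$ and an inspection time $\tau_i>0$. For $\boldsymbol\theta=(a_0,\dots,a_J,b_0,\dots,b_J)\in\mathbb R^{2(J+1)}$ put $$\alpha_i=\alpha_i(\boldsymbol\theta)=\exp\Big(\sum_{j=0}^J a_jx_{ij}\Big),\qquad \beta_i=\beta_i(\boldsymbol\theta)=\exp\Big(\sum_{j=0}^J b_jx_{ij}\Big),$$ $$F_i(\boldsymbol\theta)=\frac{\tau_i^{\beta_i}}{\tau_i^{\beta_i}+\alpha_i^{\beta_i}},\qquad R_i(\boldsymbol\theta)=1-F_i(\boldsymbol\theta)=\frac{\alpha_i^{\beta_i}}{\tau_i^{\beta_i}+\alpha_i^{\beta_i}},\qquad \boldsymbol\pi_i(\boldsymbol\theta)=(F_i(\boldsymbol\theta),R_i(\boldsymbol\theta)).$$ Let $\boldsymbol\theta_0$ be the true parameter. The lifetimes $T_{ik}$ ($1\le i\le I$, $k\ge1$) are independent random variables on a probability space, and $T_{ik}$ has the log-logistic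 density $\beta_i\alpha_i^{\beta_i}t^{\beta_i-1}/(t^{\beta_i}+\alpha_i^{\beta_i})^2$, $t>0$, with $\alpha_i=\alpha_i(\boldsymbol\theta_0)$ and $\beta_i=\beta_i(\boldsymbol\theta_0)$. Under condition $i$, $K_i$ devices are observed; $n_i=\#\{k\le K_i: T_{ik}\le\tau_i\}$ is the number of failures, $\hat{\boldsymbol p}_i=(n_i/K_i,\,1-n_i/K_i)$ and $K=K_1+\dots+K_I$. For $\gamma>0$ and probability vectors $\boldsymbol p=(p_1,p_2)$, $\boldsymbol q=(q_1,q_2)$ let $$D_\gamma(\boldsymbol p,\boldsymbol q)=\sum_{j=1}^2 q_j^{\gamma+1}-\frac{\gamma+1}{\gamma}\sum_{j=1}^2p_jq_j^{\gamma}+\frac1\gamma\sum_{j=1}^2p_j^{\gamma+1},$$ and let $D_0(\boldsymbol p,\boldsymbol q)=\sum_{j=1}^2p_j\log(p_j/q_j)$ be the Kullback–Leibler divergence ($0\log0=0$). For $\gamma\ge0$ and a parameter space $\Theta\subseteq\mathbb R^{2(J+1)}$ (for instance $\Theta=\mathbb R^{2(J+1)}$), the weighted minimum density power divergence estimator (WMDPDE)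 $\hat{\boldsymbol\theta}_\gamma$ is any random vector that, almost surely, is a global minimizer over $\Theta$ of $$\boldsymbol\theta\mapsto\sum_{i=1}^I\frac{K_i}{K}D_\gamma(\hat{\boldsymbol p}_i,\boldsymbol\pi_i(\boldsymbol\theta))$$ whenever a minimizer exists (its value is arbitrary otherwise). **Assumptions.** The numbers $K_i$ vary along a sequence with $K\to\infty$ and $K_i/K\to w_i>0$ for every $i$ (for fixed proportions, $w_i=K_i/K$). The point $\boldsymbol\theta_0$ is interior to $\Theta$ and identifiable in $\Theta$: for every $\varepsilon>0$ there is $\delta>0$ such that every $\boldsymbol\theta\in\Theta$ with $\|\boldsymbol\theta-\boldsymbol\theta_0\|\ge\varepsilon$ satisfies $|F_i(\boldsymbol\theta)-F_i(\boldsymbol\theta_0)|\ge\delta$ for some $i$. The matrix $\boldsymbol J_\gamma(\boldsymbol\theta_0)$ below is invertible. **Theorem** (asymptotic distribution of the WMDPDE under log-logistic lifetimes). For every $\gamma\ge0$, the matrix $\boldsymbol J_\gamma^{-1}(\boldsymbol\theta_0)\boldsymbol K_\gamma(\boldsymbol\theta_0)\boldsymbol J_\gamma^{-1}(\boldsymbol\theta_0)$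 is positive semidefinite and $$\sqrt K\,(\hat{\boldsymbol\theta}_\gamma-\boldsymbol\theta_0)\ \xrightarrow{\ \mathcal L\ }\ \mathcal N\big(\boldsymbol 0_{2(J+1)},\ \boldsymbol J_\gamma^{-1}(\boldsymbol\theta_0)\,\boldsymbol K_\gamma(\boldsymbol\theta_0)\,\boldsymbol J_\gamma^{-1}(\boldsymbol\theta_0)\big),$$ where $$\boldsymbol J_\gamma(\boldsymbol\theta)=\sum_{i=1}^I w_i\,\big(R_iF_i\big)^2\big(F_i^{\gamma-1}+R_i^{\gamma-1}\big)\,\boldsymbol M_i,\qquad \boldsymbol K_\gamma(\boldsymbol\theta)=\sum_{i=1}^I w_i\,\big(F_i^{\gamma-1}+R_i^{\gamma-1}\big)^2F_i^3R_i^3\,\boldsymbol M_i,$$ $$\boldsymbol M_i=\begin{pmatrix}\beta_i^2\,\boldsymbol x_i\boldsymbol x_i^T&-\log\frac{\tau_i}{\alpha_i}\,\beta_i^2\,\boldsymbol x_i\boldsymbol x_i^T\\[2pt]-\log\frac{\tau_i}{\alpha_i}\,\beta_i^2\,\boldsymbol x_i\boldsymbol x_i^T&\big(\log\frac{\tau_i}{\alpha_i}\,\beta_i\big)^2\boldsymbol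 x_i\boldsymbol x_i^T\end{pmatrix},$$ with $F_i,R_i,\alpha_i,\beta_i$ evaluated at $\boldsymbol\theta$. -/

import Mathlib

open MeasureTheory ProbabilityTheory Filter Topology

noncomputable section

namespace OneShot

/-! ### The log-logistic distribution -/

/-- Log-logistic density with scale `α` and shape `β`; it is supported on `(0, ∞)`. -/
def logLogisticPDF (α β t : ℝ) : ℝ :=
  if 0 < t then β * α ^ β * t ^ (β - 1) / (t ^ β + α ^ β) ^ 2 else 0

/-- Law with the log-logistic density. -/
def logLogisticMeasure (α β : ℝ) : Measure ℝ :=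
  volume.withDensity fun t => ENNReal.ofReal (logLogisticPDF α β t)

/-- Log-logistic distribution function at `t > 0`. -/
def logLogisticCDF (α β t : ℝ) : ℝ := t ^ β / (t ^ β + α ^ β)

/-- Log-logistic reliability (survival) function at `t > 0`. -/
def logLogisticRel (α β t : ℝ) : ℝ := α ^ β / (t ^ β + α ^ β)

/-! ### The accelerated life test -/

/-- A test plan with `I` testing conditions and `J` stress factors: covariate vectors
`x i = (x i 0, …, x i J)` and inspection times `τ i > 0`. -/
structure Design (I J : ℕ) where
  x : Fin I → Fin (J + 1) → ℝ
  τ : Fin I → ℝ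
  τ_pos : ∀ i, 0 < τ i

/-- Parameters `θ = (a_0, …, a_J, b_0, …, b_J)`, with `a j = θ (Sum.inl j)` and
`b j = θ (Sum.inr j)`, in Euclidean space of dimension `2 (J + 1)`. -/
abbrev Param (J : ℕ) : Type := EuclideanSpace ℝ (Fin (J + 1) ⊕ Fin (J + 1))

variable {I J : ℕ}

/-- Scale `α_i = exp (∑ j, a_j x_ij)`. -/
def scale (D : Design I J) (θ : Param J) (i : Fin I) : ℝ :=
  Real.exp (∑ j, θ (Sum.inl j) * D.x i j)

/-- Shape `β_i = exp (∑ j, b_j x_ij)`. -/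
def shape (D : Design I J) (θ : Param J) (i : Fin I) : ℝ :=
  Real.exp (∑ j, θ (Sum.inr j) * D.x i j)

/-- `F_i(θ)`: probability of failure before the inspection time under condition `i`. -/
def failProb (D : Design I J) (θ : Param J) (i : Fin I) : ℝ :=
  logLogisticCDF (scale D θ i) (shape D θ i) (D.τ i)

/-- `R_i(θ)`: reliability at the inspection time under condition `i`. -/
def relProb (D : Design I J) (θ : Param J) (i : Fin I) : ℝ :=
  logLogisticRel (scale D θ i) (shape D θ i) (D.τ i)

/-- Theoretical probability vector `π_i(θ) = (F_i(θ), R_i(θ))`. -/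
def modelProb (D : Design I J) (θ : Param J) (i : Fin I) : Fin 2 → ℝ :=
  ![failProb D θ i, relProb D θ i]

/-- Empirical probability vector from `n` failures among `K` devices. -/
def empProb (K n : ℕ) : Fin 2 → ℝ := ![(n : ℝ) / K, 1 - (n : ℝ) / K]

/-- Number of failures under condition `i` among the first `K` devices, with lifetimes
`t 0, …, t (K - 1)`. -/
def failures (D : Design I J) (i : Fin I) (K : ℕ) (t : ℕ → ℝ) : ℕ :=
  ((Finset.range K).filter fun k => t k ≤ D.τ i).card

/-! ### The weighted minimum density power divergence estimator -/

/-- Density power divergence with tuning parameter `γ` between two probability vectors; for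
`γ = 0` it is the Kullback-Leibler divergence (with `0 log 0 = 0`). -/
def dpd (γ : ℝ) (p q : Fin 2 → ℝ) : ℝ :=
  if γ = 0 then ∑ j, p j * Real.log (p j / q j)
  else ∑ j, q j ^ (γ + 1) - (γ + 1) / γ * ∑ j, p j * q j ^ γ + 1 / γ * ∑ j, p j ^ (γ + 1)

/-- Weighted density power divergence `∑ i, (K_i / K) D_γ(p̂_i, π_i(θ))`, where `K = ∑ i, K_i`. -/
def wdpd (D : Design I J) (γ : ℝ) (K n : Fin I → ℕ) (θ : Param J) : ℝ :=
  ∑ i, (K i : ℝ) / (∑ l, (K l : ℝ)) * dpd γ (empProb (K i) (n i)) (modelProb D θ i)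

/-- `θ` is a value of the WMDPDE over the parameter space `Θ`: a global minimizer over `Θ` of the
weighted density power divergence. -/
def IsWMDPDE (D : Design I J) (Θ : Set (Param J)) (γ : ℝ) (K n : Fin I → ℕ) (θ : Param J) : Prop :=
  θ ∈ Θ ∧ IsMinOn (wdpd D γ K n) Θ θ

/-- The parameter value `θ₀` is (strongly) identifiable in `Θ`: parameters of `Θ` away from `θ₀`
have failure probabilities away from those of `θ₀`. For compact `Θ` this only says that no other
parameter of `Θ` has the same failure probabilities as `θ₀`. -/
def IdentifiableAt (D : Design I J) (Θ : Set (Param J)) (θ₀ : Param J) : Prop :=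
  ∀ ε > 0, ∃ δ > 0, ∀ θ ∈ Θ, ε ≤ dist θ θ₀ → ∃ i, δ ≤ |failProb D θ i - failProb D θ₀ i|

/-! ### The matrices of the asymptotic covariance -/

/-- The block matrix `M_i`. -/
def matM (D : Design I J) (θ : Param J) (i : Fin I) :
    Matrix (Fin (J + 1) ⊕ Fin (J + 1)) (Fin (J + 1) ⊕ Fin (J + 1)) ℝ :=
  let β := shape D θ i
  let L := Real.log (D.τ i / scale D θ i)
  let X := Matrix.vecMulVec (D.x i) (D.x i)
  Matrix.fromBlocks (β ^ 2 • X) ((-L * β ^ 2) • X) ((-L * β ^ 2) • X) ((L * β) ^ 2 • X)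

/-- `J_γ(θ)`, with weight `w i` for condition `i`. -/
def matJ (D : Design I J) (w : Fin I → ℝ) (γ : ℝ) (θ : Param J) :
    Matrix (Fin (J + 1) ⊕ Fin (J + 1)) (Fin (J + 1) ⊕ Fin (J + 1)) ℝ :=
  ∑ i, (w i * (relProb D θ i * failProb D θ i) ^ 2 *
    (failProb D θ i ^ (γ - 1) + relProb D θ i ^ (γ - 1))) • matM D θ i

/-- `K_γ(θ)`, with weight `w i` for condition `i`. -/
def matK (D : Design I J) (w : Fin I → ℝ) (γ : ℝ) (θ : Param J) :
    Matrix (Fin (J + 1) ⊕ Fin (J + 1)) (Fin (J + 1) ⊕ Fin (J + 1)) ℝ :=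
  ∑ i, (w i * (failProb D θ i ^ (γ - 1) + relProb D θ i ^ (γ - 1)) ^ 2 *
    failProb D θ i ^ 3 * relProb D θ i ^ 3) • matM D θ i

/-- The sandwich covariance `J_γ(θ)⁻¹ K_γ(θ) J_γ(θ)⁻¹`. -/
def asympCov (D : Design I J) (w : Fin I → ℝ) (γ : ℝ) (θ : Param J) :
    Matrix (Fin (J + 1) ⊕ Fin (J + 1)) (Fin (J + 1) ⊕ Fin (J + 1)) ℝ :=
  (matJ D w γ θ)⁻¹ * matK D w γ θ * (matJ D w γ θ)⁻¹

end OneShot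

end

/-! For two-point vectors the derivative of `q ↦ D_γ(p, q)` is `(γ + 1) (q - p)` times a weight
bounded below by a positive constant. An interior minimizer therefore solves `∑ u_i (F_i(θ) - p_i)
score_i(θ) = 0`, with `u_i = K_i / K` and `p_i = n_i / K_i`.

The analysis of this problem is deterministic, in a neighbourhood of the limit data `(w, F(θ₀))`.
Strong convexity of the divergence (`exists_binDpd_ge`) and identifiability make the objective at
any distant parameter exceed its value at `θ₀` (`eventually_risk_lt`). Hence minimizers exist and
all lie near `θ₀`, without compactness of `Θ`. Linearizing the estimating equation
(`estimating_isLittleO`), whose derivative in `θ` is `J_γ(θ₀)`, gives `θ - θ₀ = ∑ (p_i - F_i(θ₀))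
influence_i` up to an error of smaller order than the deviation of `p`
(`eventually_isMinOn_expansion`).

Randomness enters only through the failure counts, which are sums of independent Bernoulli
variables. Characteristic functions reduce the limit of the linear part to the one-dimensional
central limit theorem (`tendsto_charFun_sum_smul`), and `dotProduct_asympCov` identifies its
variance with the sandwich matrix. Chebyshev's inequality makes the remainder negligible, and a
Slutsky argument concludes. -/

namespace OneShot

/-! ### The density power divergence between Bernoulli laws -/

/-- The weight `q ^ (γ - 1) + (1 - q) ^ (γ - 1)` in the derivative of the divergence. -/
noncomputable def dpdWeight (γ q : ℝ) : ℝ := q ^ (γ - 1) + (1 - q) ^ (γ - 1)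

/-- Density power divergence between the Bernoulli laws with parameters `p` and `q`. -/
noncomputable def binDpd (γ p q : ℝ) : ℝ := dpd γ ![p, 1 - p] ![q, 1 - q]

lemma binDpd_zero (p q : ℝ) :
    binDpd 0 p q = p * Real.log (p / q) + (1 - p) * Real.log ((1 - p) / (1 - q)) := by
  simp [binDpd, dpd]

lemma binDpd_of_ne {γ : ℝ} (hγ : γ ≠ 0) (p q : ℝ) :
    binDpd γ p q = q ^ (γ + 1) + (1 - q) ^ (γ + 1)
      - (γ + 1) / γ * (p * q ^ γ + (1 - p) * (1 - q) ^ γ)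
      + 1 / γ * (p ^ (γ + 1) + (1 - p) ^ (γ + 1)) := by
  simp [binDpd, dpd, hγ]

lemma hasDerivAt_mul_log_div {p q : ℝ} (hq : q ≠ 0) :
    HasDerivAt (fun q => p * Real.log (p / q)) (-p / q) q := by
  rcases eq_or_ne p 0 with rfl | hp
  · simpa using hasDerivAt_const q (0 : ℝ)
  · have h := (((hasDerivAt_const q p).div (hasDerivAt_id q) hq).log
      (div_ne_zero hp hq)).const_mul p
    refine h.congr_deriv ?_
    simp only [id_eq, Pi.div_apply]
    field_simp
    ring

lemma hasDerivAt_binDpd (γ p : ℝ) {q : ℝ} (h0 : 0 < q) (h1 : q < 1) :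
    HasDerivAt (binDpd γ p) ((γ + 1) * (q - p) * dpdWeight γ q) q := by
  have hq' : 0 < 1 - q := by linarith
  have hsub : HasDerivAt (fun q : ℝ => 1 - q) (-1) q := by
    simpa using (hasDerivAt_id q).const_sub 1
  rcases eq_or_ne γ 0 with rfl | hγ
  · have hf : binDpd 0 p = fun q => p * Real.log (p / q) +
        (1 - p) * Real.log ((1 - p) / (1 - q)) := funext (binDpd_zero p)
    rw [hf]
    have h := (hasDerivAt_mul_log_div (p := p) h0.ne').add
      ((hasDerivAt_mul_log_div (p := 1 - p) hq'.ne').comp q hsub)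
    refine h.congr_deriv ?_
    rw [dpdWeight, zero_sub, Real.rpow_neg_one, Real.rpow_neg_one]
    field_simp
    ring
  · have hf : binDpd γ p = fun q => q ^ (γ + 1) + (1 - q) ^ (γ + 1)
        - (γ + 1) / γ * (p * q ^ γ + (1 - p) * (1 - q) ^ γ)
        + 1 / γ * (p ^ (γ + 1) + (1 - p) ^ (γ + 1)) := funext (binDpd_of_ne hγ p)
    rw [hf]
    have hp (r : ℝ) : HasDerivAt (fun q : ℝ => q ^ r) (r * q ^ (r - 1)) q :=
      Real.hasDerivAt_rpow_const (Or.inl h0.ne')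
    have hp' (r : ℝ) : HasDerivAt (fun q : ℝ => (1 - q) ^ r) (r * (1 - q) ^ (r - 1) * (-1)) q :=
      (Real.hasDerivAt_rpow_const (Or.inl hq'.ne')).comp q hsub
    have h := (((hp (γ + 1)).add (hp' (γ + 1))).sub
      ((((hp γ).const_mul p).add ((hp' γ).const_mul (1 - p))).const_mul ((γ + 1) / γ))).add_const
      (1 / γ * (p ^ (γ + 1) + (1 - p) ^ (γ + 1)))
    refine h.congr_deriv ?_
    have e1 : q ^ γ = q ^ (γ - 1) * q := by
      rw [← Real.rpow_add_one h0.ne', sub_add_cancel]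
    have e2 : (1 - q) ^ γ = (1 - q) ^ (γ - 1) * (1 - q) := by
      rw [← Real.rpow_add_one hq'.ne', sub_add_cancel]
    rw [dpdWeight, add_sub_cancel_right, e1, e2]
    field_simp
    ring

lemma rpow_half_abs_le {x : ℝ} (h0 : 1 / 2 ≤ x) (h1 : x ≤ 1) (s : ℝ) :
    (1 / 2 : ℝ) ^ |s| ≤ x ^ s :=
  (Real.rpow_le_rpow (by norm_num) h0 (abs_nonneg s)).trans
    (Real.rpow_le_rpow_of_exponent_ge (by linarith) h1 (le_abs_self s))

/-- One of `q` and `1 - q` is at least `1 / 2`, and the other power is positive. The bound is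
uniform in `q`, which near the endpoints neither power alone provides when `γ > 1`. -/
lemma le_dpdWeight (γ : ℝ) {q : ℝ} (h0 : 0 < q) (h1 : q < 1) :
    (1 / 2 : ℝ) ^ |γ - 1| ≤ dpdWeight γ q := by
  have h2 : 0 < q ^ (γ - 1) := Real.rpow_pos_of_pos h0 _
  have h3 : 0 < (1 - q) ^ (γ - 1) := Real.rpow_pos_of_pos (by linarith) _
  rw [dpdWeight]
  rcases le_total (1 / 2) q with h | h
  · linarith [rpow_half_abs_le h h1.le (γ - 1)]
  · linarith [rpow_half_abs_le (x := 1 - q) (by linarith) (by linarith) (γ - 1)]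

/-- The divergence is uniformly strongly convex around the diagonal. -/
lemma exists_binDpd_ge {γ : ℝ} (hγ : 0 ≤ γ) :
    ∃ κ > 0, ∀ p q, 0 < p → p < 1 → 0 < q → q < 1 →
      binDpd γ p p + κ * (q - p) ^ 2 ≤ binDpd γ p q := by
  -- With `κ` half the lower bound `c` of the weight, subtracting `κ (q - p) ^ 2` leaves a
  -- derivative with the sign of `q - p`, because `γ + 1 ≥ 1`; so `p` remains the minimum.
  refine ⟨(1 / 2 : ℝ) ^ |γ - 1| / 2, by positivity, fun p q hp0 hp1 hq0 hq1 => ?_⟩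
  set c := (1 / 2 : ℝ) ^ |γ - 1| with hc
  have hcpos : 0 < c := by positivity
  let g : ℝ → ℝ := fun q => binDpd γ p q - c / 2 * (q - p) ^ 2
  have hg (x : ℝ) (hx0 : 0 < x) (hx1 : x < 1) :
      HasDerivAt g ((x - p) * ((γ + 1) * dpdWeight γ x - c)) x := by
    have h := (hasDerivAt_binDpd γ p hx0 hx1).sub
      ((((hasDerivAt_id x).sub_const p).pow 2).const_mul (c / 2))
    refine h.congr_deriv ?_
    simp only [id_eq]
    push_cast
    ring
  have hw (x : ℝ) (hx0 : 0 < x) (hx1 : x < 1) : 0 ≤ (γ + 1) * dpdWeight γ x - c := by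
    have := le_dpdWeight γ hx0 hx1
    nlinarith
  suffices h : g p ≤ g q by
    simp only [g] at h
    nlinarith
  rcases le_total p q with h | h
  · refine monotoneOn_of_deriv_nonneg (convex_Icc p q)
      (fun x hx => (hg x (by linarith [hx.1]) (by linarith [hx.2])).continuousAt.continuousWithinAt)
      (fun x hx => ?_) (fun x hx => ?_) (Set.left_mem_Icc.2 h) (Set.right_mem_Icc.2 h) h
    · rw [interior_Icc] at hx
      exact (hg x (by linarith [hx.1]) (by linarith [hx.2])).differentiableAt.differentiableWithinAt
    · rw [interior_Icc] at hx
      have hx0 : 0 < x := by linarith [hx.1]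
      have hx1 : x < 1 := by linarith [hx.2]
      rw [(hg x hx0 hx1).deriv]
      exact mul_nonneg (by linarith [hx.1]) (hw x hx0 hx1)
  · refine antitoneOn_of_deriv_nonpos (convex_Icc q p)
      (fun x hx => (hg x (by linarith [hx.1]) (by linarith [hx.2])).continuousAt.continuousWithinAt)
      (fun x hx => ?_) (fun x hx => ?_) (Set.left_mem_Icc.2 h) (Set.right_mem_Icc.2 h) h
    · rw [interior_Icc] at hx
      exact (hg x (by linarith [hx.1]) (by linarith [hx.2])).differentiableAt.differentiableWithinAt
    · rw [interior_Icc] at hx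
      have hx0 : 0 < x := by linarith [hx.1]
      have hx1 : x < 1 := by linarith [hx.2]
      rw [(hg x hx0 hx1).deriv]
      exact mul_nonpos_of_nonpos_of_nonneg (by linarith [hx.2]) (hw x hx0 hx1)

/-- The two terms are continuous at the interior point `p₀` and coincide there, so the value of the
divergence on the diagonal is never needed. -/
lemma tendsto_binDpd_sub (γ : ℝ) {p₀ : ℝ} (h0 : 0 < p₀) (h1 : p₀ < 1) :
    Tendsto (fun p => binDpd γ p p₀ - binDpd γ p p) (𝓝 p₀) (𝓝 0) := by
  have h1' : 1 - p₀ ≠ 0 := by linarith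
  have hc : ContinuousAt (fun p => binDpd γ p p₀ - binDpd γ p p) p₀ := by
    rcases eq_or_ne γ 0 with rfl | hγ
    · simp only [binDpd_zero]
      have hid : ContinuousAt (fun p : ℝ => p) p₀ := continuousAt_id
      have hs : ContinuousAt (fun p : ℝ => 1 - p) p₀ := by fun_prop
      have a1 : p₀ / p₀ ≠ 0 := div_ne_zero h0.ne' h0.ne'
      have a2 : (1 - p₀) / (1 - p₀) ≠ 0 := div_ne_zero h1' h1'
      exact ((hid.mul ((hid.div_const _).log a1)).add (hs.mul ((hs.div_const _).log a2))).sub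
        ((hid.mul ((hid.div hid h0.ne').log a1)).add (hs.mul ((hs.div hs h1').log a2)))
    · simp only [binDpd_of_ne hγ]
      have hr (r : ℝ) : ContinuousAt (fun p : ℝ => p ^ r) p₀ :=
        Real.continuousAt_rpow_const p₀ r (Or.inl h0.ne')
      have hs : ContinuousAt (fun p : ℝ => 1 - p) p₀ := by fun_prop
      have hr' (r : ℝ) : ContinuousAt (fun p : ℝ => (1 - p) ^ r) p₀ :=
        hs.rpow_const (Or.inl h1')
      have hid : ContinuousAt (fun p : ℝ => p) p₀ := continuousAt_id
      exact ((continuousAt_const.sub (continuousAt_const.mul ((hid.mul_const _).add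
        (hs.mul_const _)))).add (continuousAt_const.mul ((hr _).add (hr' _)))).sub
        ((((hr _).add (hr' _)).sub (continuousAt_const.mul ((hid.mul (hr _)).add
        (hs.mul (hr' _))))).add (continuousAt_const.mul ((hr _).add (hr' _))))
  simpa [ContinuousAt] using hc

lemma continuousAt_dpdWeight (γ : ℝ) {q : ℝ} (h0 : 0 < q) (h1 : q < 1) :
    ContinuousAt (dpdWeight γ) q :=
  (Real.continuousAt_rpow_const _ _ (Or.inl h0.ne')).add
    (ContinuousAt.rpow_const (by fun_prop) (Or.inl (by linarith)))

/-! ### The failure probabilities -/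

/-- On the logit scale the model becomes `β (log t - log α)`; the bounds and the gradient of `F_i`
are read off from this form. -/
lemma logLogisticCDF_eq_sigmoid {α t : ℝ} (β : ℝ) (hα : 0 < α) (ht : 0 < t) :
    logLogisticCDF α β t = Real.sigmoid (β * (Real.log t - Real.log α)) := by
  have h1 : 0 < t ^ β := Real.rpow_pos_of_pos ht β
  have h2 : Real.exp (-(β * (Real.log t - Real.log α))) = α ^ β / t ^ β := by
    rw [Real.rpow_def_of_pos hα, Real.rpow_def_of_pos ht, ← Real.exp_sub]
    congr 1
    ring
  rw [logLogisticCDF, Real.sigmoid_def, h2]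
  have h3 : 0 < α ^ β := Real.rpow_pos_of_pos hα β
  field_simp

lemma logLogisticRel_eq {α t : ℝ} (β : ℝ) (hα : 0 < α) (ht : 0 < t) :
    logLogisticRel α β t = 1 - logLogisticCDF α β t := by
  have h1 : 0 < t ^ β := Real.rpow_pos_of_pos ht β
  have h3 : 0 < α ^ β := Real.rpow_pos_of_pos hα β
  rw [logLogisticRel, logLogisticCDF]
  field_simp
  ring

variable {I J : ℕ} (D : Design I J) (θ : Param J) (i : Fin I)

lemma scale_pos : 0 < scale D θ i := Real.exp_pos _

lemma shape_pos : 0 < shape D θ i := Real.exp_pos _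

lemma relProb_eq : relProb D θ i = 1 - failProb D θ i :=
  logLogisticRel_eq _ (scale_pos D θ i) (D.τ_pos i)

lemma failProb_eq_sigmoid : failProb D θ i =
    Real.sigmoid (shape D θ i * (Real.log (D.τ i) - ∑ j, θ (Sum.inl j) * D.x i j)) := by
  rw [failProb, logLogisticCDF_eq_sigmoid _ (scale_pos D θ i) (D.τ_pos i)]
  simp only [scale, Real.log_exp]

lemma failProb_pos : 0 < failProb D θ i := by
  rw [failProb_eq_sigmoid]
  exact Real.sigmoid_pos _

lemma failProb_lt_one : failProb D θ i < 1 := by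
  rw [failProb_eq_sigmoid]
  exact Real.sigmoid_lt_one _

/-- Gradient of the logit of the failure probability. -/
noncomputable def logitGrad : Fin (J + 1) ⊕ Fin (J + 1) → ℝ :=
  Sum.elim (fun j => -(shape D θ i * D.x i j))
    (fun j => shape D θ i * Real.log (D.τ i / scale D θ i) * D.x i j)

/-- Gradient of the failure probability. -/
noncomputable def failGrad : Param J :=
  (failProb D θ i * relProb D θ i) • WithLp.toLp 2 (logitGrad D θ i)

lemma log_div_scale : Real.log (D.τ i / scale D θ i) =
    Real.log (D.τ i) - ∑ j, θ (Sum.inl j) * D.x i j := by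
  rw [Real.log_div (D.τ_pos i).ne' (scale_pos D θ i).ne', scale, Real.log_exp]

/-- The blocks are products of the two halves of one vector. This rank-one form turns the later
matrix identities into sums of inner products. -/
lemma matM_eq_vecMulVec :
    matM D θ i = Matrix.vecMulVec (logitGrad D θ i) (logitGrad D θ i) := by
  ext (a | a) (b | b) <;>
    simp [matM, logitGrad, Matrix.vecMulVec_apply] <;> ring

lemma hasFDerivAt_failProb :
    HasFDerivAt (fun θ => failProb D θ i) (innerSL ℝ (failGrad D θ i)) θ := by
  let A : Param J →L[ℝ] ℝ := ∑ j, D.x i j • EuclideanSpace.proj (Sum.inl j)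
  let B : Param J →L[ℝ] ℝ := ∑ j, D.x i j • EuclideanSpace.proj (Sum.inr j)
  have hA (η : Param J) : A η = ∑ j, η (Sum.inl j) * D.x i j := by
    simp [A, mul_comm]
  have hB (η : Param J) : B η = ∑ j, η (Sum.inr j) * D.x i j := by
    simp [B, mul_comm]
  have hf : (fun θ => failProb D θ i) = fun η =>
      Real.sigmoid (Real.exp (B η) * (Real.log (D.τ i) - A η)) := by
    funext η
    rw [failProb_eq_sigmoid, shape, hA, hB]
  have h := (Real.hasDerivAt_sigmoid _).comp_hasFDerivAt θ
    ((B.hasFDerivAt (x := θ)).exp.mul ((A.hasFDerivAt (x := θ)).const_sub (Real.log (D.τ i))))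
  rw [hf]
  refine h.congr_fderiv ?_
  ext η
  have e1 : Real.exp (B θ) = shape D θ i := by rw [hB, shape]
  have e2 : Real.log (D.τ i) - A θ = Real.log (D.τ i / scale D θ i) := by
    rw [hA, log_div_scale]
  have e3 : Real.sigmoid (shape D θ i * Real.log (D.τ i / scale D θ i)) = failProb D θ i := by
    rw [failProb_eq_sigmoid, log_div_scale]
  have e4 : inner ℝ (WithLp.toLp 2 (logitGrad D θ i)) η =
      shape D θ i * Real.log (D.τ i / scale D θ i) * B η - shape D θ i * A η := by
    rw [hA, hB, Finset.mul_sum, Finset.mul_sum]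
    simp only [PiLp.inner_apply, Fintype.sum_sum_type, logitGrad, Sum.elim_inl, Sum.elim_inr,
      RCLike.inner_apply, conj_trivial]
    rw [add_comm, sub_eq_add_neg, ← Finset.sum_neg_distrib]
    congr 1 <;> exact Finset.sum_congr rfl fun j _ => by ring
  rw [innerSL_apply_apply, failGrad, real_inner_smul_left, e4, relProb_eq]
  simp only [Pi.mul_apply, smul_eq_mul, smul_apply,
    add_apply, neg_apply, e1, e2, e3]
  ring

lemma continuous_failProb : Continuous fun θ => failProb D θ i :=
  continuous_iff_continuousAt.2 fun θ => (hasFDerivAt_failProb D θ i).continuousAt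

lemma continuous_failGrad : Continuous fun θ => failGrad D θ i := by
  have h1 : Continuous fun θ => failProb D θ i := continuous_failProb D i
  have h2 : Continuous fun θ => shape D θ i := by unfold shape; fun_prop
  have h3 : Continuous fun θ => Real.log (D.τ i / scale D θ i) := by
    simp only [log_div_scale]; fun_prop
  have h4 : Continuous fun θ => logitGrad D θ i := by
    refine continuous_pi fun a => ?_
    rcases a with a | a <;> simp only [logitGrad, Sum.elim_inl, Sum.elim_inr] <;> fun_prop
  simp only [failGrad, relProb_eq]
  fun_prop

/-- Estimating function of the estimator for condition `i`. -/
noncomputable def score (γ : ℝ) : Param J := dpdWeight γ (failProb D θ i) • failGrad D θ i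

lemma continuous_score (γ : ℝ) : Continuous fun θ => score D θ i γ := by
  have h : Continuous fun θ : Param J => dpdWeight γ (failProb D θ i) := by
    refine continuous_iff_continuousAt.2 fun θ => ?_
    exact ContinuousAt.comp (x := θ) (f := fun θ : Param J => failProb D θ i)
      (continuousAt_dpdWeight γ (failProb_pos D θ i) (failProb_lt_one D θ i))
      (continuous_failProb D i).continuousAt
  exact h.smul (continuous_failGrad D i)

end OneShot

/-! ### Deterministic analysis: localization and expansion of minimizers. -/

namespace OneShot

variable {I J : ℕ} (D : Design I J)

/-! ### The objective function -/

/-- Weighted divergence between failure frequencies `p` and the model, with weights `u`. -/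
noncomputable def risk (γ : ℝ) (u p : Fin I → ℝ) (θ : Param J) : ℝ :=
  ∑ i, u i * binDpd γ (p i) (failProb D θ i)

lemma wdpd_eq_risk (γ : ℝ) (K n : Fin I → ℕ) :
    wdpd D γ K n = risk D γ (fun i => (K i : ℝ) / ∑ l, (K l : ℝ)) (fun i => (n i : ℝ) / K i) := by
  funext θ
  simp only [wdpd, risk, binDpd, empProb, modelProb, relProb_eq]

lemma hasFDerivAt_risk (γ : ℝ) (u p : Fin I → ℝ) (θ : Param J) :
    HasFDerivAt (risk D γ u p)
      (innerSL ℝ ((γ + 1) • ∑ i, (u i * (failProb D θ i - p i)) • score D θ i γ)) θ := by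
  have h : HasFDerivAt (risk D γ u p) (∑ i, u i • (((γ + 1) * (failProb D θ i - p i) *
      dpdWeight γ (failProb D θ i)) • innerSL ℝ (failGrad D θ i))) θ := by
    refine HasFDerivAt.fun_sum fun i _ => HasFDerivAt.const_mul ?_ _
    exact (hasDerivAt_binDpd γ (p i) (failProb_pos D θ i)
      (failProb_lt_one D θ i)).comp_hasFDerivAt (f := fun θ => failProb D θ i) θ
      (hasFDerivAt_failProb D θ i)
  refine h.congr_fderiv ?_
  simp only [score, map_smul, map_sum, Finset.smul_sum, smul_smul]
  exact Finset.sum_congr rfl fun i _ => by congr 1; ring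

lemma continuous_risk (γ : ℝ) (u p : Fin I → ℝ) : Continuous (risk D γ u p) :=
  continuous_iff_continuousAt.2 fun θ => (hasFDerivAt_risk D γ u p θ).continuousAt

/-- An interior minimizer solves the estimating equations. -/
lemma sum_score_eq_zero {γ : ℝ} (hγ : 0 ≤ γ) {u p : Fin I → ℝ} {θ : Param J}
    (h : IsLocalMin (risk D γ u p) θ) :
    ∑ i, (u i * (failProb D θ i - p i)) • score D θ i γ = 0 := by
  have h0 := h.hasFDerivAt_eq_zero (hasFDerivAt_risk D γ u p θ)
  have h1 : (γ + 1) • ∑ i, (u i * (failProb D θ i - p i)) • score D θ i γ = 0 := by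
    rw [← norm_eq_zero, ← innerSL_apply_norm ℝ, h0, norm_zero]
  exact (smul_eq_zero.1 h1).resolve_left (by linarith)

variable {D} {Θ : Set (Param J)} {θ₀ : Param J} {γ : ℝ} {w : Fin I → ℝ}

/-- When the weights and frequencies are close to their limits, the objective function at
parameters away from the true one exceeds its value at the true parameter. -/
lemma eventually_risk_lt (hid : IdentifiableAt D Θ θ₀) (hγ : 0 ≤ γ) (hw : ∀ i, 0 < w i)
    {ε : ℝ} (hε : 0 < ε) :
    ∀ᶠ z : (Fin I → ℝ) × (Fin I → ℝ) in 𝓝 (w, failProb D θ₀),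
      ∀ θ ∈ Θ, ε ≤ dist θ θ₀ → risk D γ z.1 z.2 θ₀ < risk D γ z.1 z.2 θ := by
  obtain ⟨δ, hδ, hsep⟩ := hid ε hε
  obtain ⟨κ, hκ, hconv⟩ := exists_binDpd_ge hγ
  have hu (i : Fin I) : Tendsto (fun z : (Fin I → ℝ) × (Fin I → ℝ) => z.1 i)
      (𝓝 (w, failProb D θ₀)) (𝓝 (w i)) :=
    ((continuous_apply i).comp continuous_fst).tendsto _
  have hp (i : Fin I) : Tendsto (fun z : (Fin I → ℝ) × (Fin I → ℝ) => z.2 i)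
      (𝓝 (w, failProb D θ₀)) (𝓝 (failProb D θ₀ i)) :=
    ((continuous_apply i).comp continuous_snd).tendsto _
  -- Excess of the objective at `θ₀` over the baseline `∑ u_i D_γ(p_i, p_i)`, which does not depend
  -- on `θ`.
  have hG : Tendsto (fun z : (Fin I → ℝ) × (Fin I → ℝ) => ∑ i, z.1 i *
      (binDpd γ (z.2 i) (failProb D θ₀ i) - binDpd γ (z.2 i) (z.2 i)))
      (𝓝 (w, failProb D θ₀)) (𝓝 0) := by
    have := tendsto_finsetSum Finset.univ fun i _ => (hu i).mul
      ((tendsto_binDpd_sub γ (failProb_pos D θ₀ i) (failProb_lt_one D θ₀ i)).comp (hp i))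
    simpa using this
  -- The condition separating `θ` from `θ₀` depends on `θ`, so the gap is secured for every `i`. The
  -- radius `δ / 2` leaves room for `p_i` differing from `F_i(θ₀)`.
  have hgap : ∀ᶠ z : (Fin I → ℝ) × (Fin I → ℝ) in 𝓝 (w, failProb D θ₀), ∀ i,
      ∑ i, z.1 i * (binDpd γ (z.2 i) (failProb D θ₀ i) - binDpd γ (z.2 i) (z.2 i)) <
        z.1 i * (κ * (δ / 2) ^ 2) :=
    eventually_all.2 fun i => hG.eventually_lt ((hu i).mul_const _)
      (by have := hw i; positivity)
  have hpos : ∀ᶠ z : (Fin I → ℝ) × (Fin I → ℝ) in 𝓝 (w, failProb D θ₀), ∀ i, 0 < z.1 i :=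
    eventually_all.2 fun i => (hu i).eventually_const_lt (hw i)
  have hp0 : ∀ᶠ z : (Fin I → ℝ) × (Fin I → ℝ) in 𝓝 (w, failProb D θ₀), ∀ i, 0 < z.2 i :=
    eventually_all.2 fun i => (hp i).eventually_const_lt (failProb_pos D θ₀ i)
  have hp1 : ∀ᶠ z : (Fin I → ℝ) × (Fin I → ℝ) in 𝓝 (w, failProb D θ₀), ∀ i, z.2 i < 1 :=
    eventually_all.2 fun i => (hp i).eventually_lt_const (failProb_lt_one D θ₀ i)
  have hclose : ∀ᶠ z : (Fin I → ℝ) × (Fin I → ℝ) in 𝓝 (w, failProb D θ₀), ∀ i,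
      |z.2 i - failProb D θ₀ i| < δ / 2 :=
    eventually_all.2 fun i => by
      have := (hp i).eventually (Metric.ball_mem_nhds (failProb D θ₀ i) (half_pos hδ))
      filter_upwards [this] with z hz
      simpa [Real.dist_eq] using hz
  filter_upwards [hgap, hpos, hp0, hp1, hclose] with z hgap hpos hp0 hp1 hclose θ hθ hdist
  obtain ⟨i, hi⟩ := hsep θ hθ hdist
  have hterm (l : Fin I) : z.1 l * (κ * (failProb D θ l - z.2 l) ^ 2) ≤
      z.1 l * (binDpd γ (z.2 l) (failProb D θ l) - binDpd γ (z.2 l) (z.2 l)) := by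
    have h := hconv (z.2 l) (failProb D θ l) (hp0 l) (hp1 l)
      (failProb_pos D θ l) (failProb_lt_one D θ l)
    exact mul_le_mul_of_nonneg_left (by linarith) (hpos l).le
  have hfar : δ / 2 ≤ |failProb D θ i - z.2 i| := by
    have h1 := abs_sub_le (failProb D θ i) (z.2 i) (failProb D θ₀ i)
    have h2 := hclose i
    linarith
  have hsq : (δ / 2) ^ 2 ≤ (failProb D θ i - z.2 i) ^ 2 := by
    rw [← sq_abs (failProb D θ i - z.2 i)]
    exact pow_le_pow_left₀ (half_pos hδ).le hfar 2
  have hlow : z.1 i * (κ * (δ / 2) ^ 2) ≤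
      ∑ l, z.1 l * (binDpd γ (z.2 l) (failProb D θ l) - binDpd γ (z.2 l) (z.2 l)) := by
    calc z.1 i * (κ * (δ / 2) ^ 2) ≤ z.1 i * (κ * (failProb D θ i - z.2 i) ^ 2) :=
          mul_le_mul_of_nonneg_left (mul_le_mul_of_nonneg_left hsq hκ.le) (hpos i).le
      _ ≤ ∑ l, z.1 l * (κ * (failProb D θ l - z.2 l) ^ 2) :=
          Finset.single_le_sum (f := fun l => z.1 l * (κ * (failProb D θ l - z.2 l) ^ 2))
            (fun l _ => mul_nonneg (hpos l).le (by positivity)) (Finset.mem_univ i)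
      _ ≤ _ := Finset.sum_le_sum fun l _ => hterm l
  have := (hgap i).trans_le hlow
  simp only [mul_sub, Finset.sum_sub_distrib] at this
  simp only [risk]
  linarith

/-- If the objective function is larger than at `θ₀` outside a ball contained in `Θ`, then it has
a minimizer over `Θ`. -/
lemma exists_isMinOn_risk {u p : Fin I → ℝ} {ε : ℝ} (hε : 0 < ε)
    (hball : Metric.closedBall θ₀ ε ⊆ Θ)
    (h : ∀ θ ∈ Θ, ε ≤ dist θ θ₀ → risk D γ u p θ₀ < risk D γ u p θ) :
    ∃ θ ∈ Θ, IsMinOn (risk D γ u p) Θ θ := by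
  obtain ⟨θ, hθ, hmin⟩ := (isCompact_closedBall θ₀ ε).exists_isMinOn
    ⟨θ₀, Metric.mem_closedBall_self hε.le⟩ (continuous_risk D γ u p).continuousOn
  refine ⟨θ, hball hθ, fun η hη => ?_⟩
  rcases le_total (dist η θ₀) ε with hd | hd
  · exact hmin hd
  · exact (hmin (Metric.mem_closedBall_self hε.le)).trans (h η hη hd).le

/-! ### Linearization of the estimating equations -/

/-- Since `failGrad` is `F R` times the logit gradient, `J_γ` is the derivative at `θ₀` of the
limiting estimating function. -/
lemma toEuclideanCLM_matJ_apply (h : Param J) :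
    Matrix.toEuclideanCLM (𝕜 := ℝ) (matJ D w γ θ₀) h =
      ∑ i, (w i * inner ℝ (failGrad D θ₀ i) h) • score D θ₀ i γ := by
  ext a
  have e (i : Fin I) : inner ℝ (WithLp.toLp 2 (logitGrad D θ₀ i)) h =
      logitGrad D θ₀ i ⬝ᵥ WithLp.ofLp h := by
    simp [EuclideanSpace.inner_eq_star_dotProduct, dotProduct_comm]
  simp only [Matrix.ofLp_toEuclideanCLM, matJ, Matrix.sum_mulVec, Finset.sum_apply,
    Matrix.smul_mulVec, matM_eq_vecMulVec, Matrix.vecMulVec_mulVec, WithLp.ofLp_sum, score,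
    failGrad, real_inner_smul_left, e, WithLp.ofLp_smul, Pi.smul_apply, smul_eq_mul,
    MulOpposite.smul_eq_mul_unop, MulOpposite.unop_op, relProb_eq, dpdWeight]
  exact Finset.sum_congr rfl fun i _ => by ring

/-- Each factor `F_i(θ) - p_i` vanishes at the limit point. Replacing `u_i score_i(θ)` by `w_i
score_i(θ₀)` thus costs a first-order term times `o(1)`: continuity of the score suffices, and the
gauge need not contain `u - w`. -/
lemma estimating_isLittleO :
    (fun z : ((Fin I → ℝ) × (Fin I → ℝ)) × Param J =>
      ∑ i, (z.1.1 i * (failProb D z.2 i - z.1.2 i)) • score D z.2 i γ -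
      (Matrix.toEuclideanCLM (𝕜 := ℝ) (matJ D w γ θ₀) (z.2 - θ₀) -
        ∑ i, (w i * (z.1.2 i - failProb D θ₀ i)) • score D θ₀ i γ))
    =o[𝓝 ((w, failProb D θ₀), θ₀)]
      fun z => (z.1.2 - failProb D θ₀, z.2 - θ₀) := by
  have hE : (fun z : ((Fin I → ℝ) × (Fin I → ℝ)) × Param J => z.1.2 - failProb D θ₀)
      =O[𝓝 ((w, failProb D θ₀), θ₀)] fun z => (z.1.2 - failProb D θ₀, z.2 - θ₀) :=
    Asymptotics.isBigO_of_le _ fun z => norm_fst_le (z.1.2 - failProb D θ₀, z.2 - θ₀)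
  have hH : (fun z : ((Fin I → ℝ) × (Fin I → ℝ)) × Param J => z.2 - θ₀)
      =O[𝓝 ((w, failProb D θ₀), θ₀)] fun z => (z.1.2 - failProb D θ₀, z.2 - θ₀) :=
    Asymptotics.isBigO_of_le _ fun z => norm_snd_le (z.1.2 - failProb D θ₀, z.2 - θ₀)
  have hsnd : Tendsto (fun z : ((Fin I → ℝ) × (Fin I → ℝ)) × Param J => z.2)
      (𝓝 ((w, failProb D θ₀), θ₀)) (𝓝 θ₀) := continuous_snd.tendsto _
  have hi (i : Fin I) : (fun z : ((Fin I → ℝ) × (Fin I → ℝ)) × Param J =>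
      (failProb D z.2 i - z.1.2 i) • (z.1.1 i • score D z.2 i γ) -
      (inner ℝ (failGrad D θ₀ i) (z.2 - θ₀) - (z.1.2 i - failProb D θ₀ i)) •
        (w i • score D θ₀ i γ))
      =o[𝓝 ((w, failProb D θ₀), θ₀)] fun z => (z.1.2 - failProb D θ₀, z.2 - θ₀) := by
    have hEi : (fun z : ((Fin I → ℝ) × (Fin I → ℝ)) × Param J => z.1.2 i - failProb D θ₀ i)
        =O[𝓝 ((w, failProb D θ₀), θ₀)] fun z => (z.1.2 - failProb D θ₀, z.2 - θ₀) :=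
      (Asymptotics.isBigO_of_le (g := fun z : ((Fin I → ℝ) × (Fin I → ℝ)) × Param J =>
        z.1.2 - failProb D θ₀) _ fun z => norm_le_pi_norm (z.1.2 - failProb D θ₀) i).trans hE
    have hlin : (fun z : ((Fin I → ℝ) × (Fin I → ℝ)) × Param J =>
        inner ℝ (failGrad D θ₀ i) (z.2 - θ₀))
        =O[𝓝 ((w, failProb D θ₀), θ₀)] fun z => (z.1.2 - failProb D θ₀, z.2 - θ₀) :=
      ((innerSL ℝ (failGrad D θ₀ i)).isBigO_comp
        (fun z : ((Fin I → ℝ) × (Fin I → ℝ)) × Param J => z.2 - θ₀) _).trans hH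
    have hrem : (fun z : ((Fin I → ℝ) × (Fin I → ℝ)) × Param J =>
        (failProb D z.2 i - z.1.2 i) -
          (inner ℝ (failGrad D θ₀ i) (z.2 - θ₀) - (z.1.2 i - failProb D θ₀ i)))
        =o[𝓝 ((w, failProb D θ₀), θ₀)] fun z => (z.1.2 - failProb D θ₀, z.2 - θ₀) := by
      have h := ((hasFDerivAt_failProb D θ₀ i).isLittleO.comp_tendsto hsnd).trans_isBigO hH
      refine h.congr_left fun z => ?_
      simp only [Function.comp_apply, innerSL_apply_apply]
      ring
    have hs : (fun z : ((Fin I → ℝ) × (Fin I → ℝ)) × Param J => failProb D z.2 i - z.1.2 i)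
        =O[𝓝 ((w, failProb D θ₀), θ₀)] fun z => (z.1.2 - failProb D θ₀, z.2 - θ₀) :=
      (hrem.isBigO.add (hlin.sub hEi)).congr_left fun z => by ring
    have hx : (fun z : ((Fin I → ℝ) × (Fin I → ℝ)) × Param J =>
        z.1.1 i • score D z.2 i γ - w i • score D θ₀ i γ)
        =o[𝓝 ((w, failProb D θ₀), θ₀)] fun _ => (1 : ℝ) := by
      rw [Asymptotics.isLittleO_one_iff]
      have hc : Continuous fun z : ((Fin I → ℝ) × (Fin I → ℝ)) × Param J =>
          z.1.1 i • score D z.2 i γ - w i • score D θ₀ i γ := by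
        have := continuous_score D i γ
        fun_prop
      simpa using hc.tendsto ((w, failProb D θ₀), θ₀)
    have h1 := hs.norm_right.smul_isLittleO hx
    have h3 : (fun _ : ((Fin I → ℝ) × (Fin I → ℝ)) × Param J => w i • score D θ₀ i γ)
        =O[𝓝 ((w, failProb D θ₀), θ₀)] fun _ => (1 : ℝ) := Asymptotics.isBigO_const_const _
          one_ne_zero _
    have h4 := hrem.norm_right.smul_isBigO h3
    refine Asymptotics.isLittleO_norm_right.1 (((h1.add h4).congr_right (by simp)).congr_left
      fun z => ?_)
    module
  refine (Asymptotics.IsLittleO.fun_sum (s := Finset.univ) fun i _ => hi i).congr_left fun z => ?_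
  rw [toEuclideanCLM_matJ_apply, ← Finset.sum_sub_distrib, ← Finset.sum_sub_distrib]
  refine Finset.sum_congr rfl fun i _ => ?_
  simp only [smul_smul, sub_smul, mul_sub, sub_mul]
  simp only [mul_comm]

/-- Influence of the failure frequency under condition `i` on the estimator. -/
noncomputable def influence (D : Design I J) (w : Fin I → ℝ) (γ : ℝ) (θ : Param J) (i : Fin I) :
    Param J :=
  Matrix.toEuclideanCLM (𝕜 := ℝ) (matJ D w γ θ)⁻¹ (w i • score D θ i γ)

/-- Asymptotic expansion of minimizers of the objective function. -/
theorem eventually_isMinOn_expansion (hθ₀ : θ₀ ∈ interior Θ) (hid : IdentifiableAt D Θ θ₀)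
    (hγ : 0 ≤ γ) (hw : ∀ i, 0 < w i) (hJ : IsUnit (matJ D w γ θ₀)) {η : ℝ} (hη : 0 < η) :
    ∀ᶠ z : (Fin I → ℝ) × (Fin I → ℝ) in 𝓝 (w, failProb D θ₀),
      (∃ θ ∈ Θ, IsMinOn (risk D γ z.1 z.2) Θ θ) ∧
      ∀ θ ∈ Θ, IsMinOn (risk D γ z.1 z.2) Θ θ →
        ‖θ - θ₀ - ∑ i, (z.2 i - failProb D θ₀ i) • influence D w γ θ₀ i‖ ≤
          η * ‖z.2 - failProb D θ₀‖ := by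
  set N := Matrix.toEuclideanCLM (𝕜 := ℝ) (matJ D w γ θ₀)⁻¹ with hN
  set A := ∑ i, ‖influence D w γ θ₀ i‖ with hA
  have hA0 : 0 ≤ A := Finset.sum_nonneg fun i _ => norm_nonneg _
  -- The `1 / 2` lets `‖h‖` be absorbed into the left side, giving `‖h‖ ≤ (2 * A + 1) * ‖e‖`; the
  -- other bound then makes `η' * (‖e‖ + ‖h‖) ≤ η * ‖e‖`.
  set η' := min (1 / 2) (η / (2 * A + 2)) with hη'
  have hη'0 : 0 < η' := lt_min (by norm_num) (by positivity)
  have hη'1 : η' ≤ 1 / 2 := min_le_left _ _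
  have hη'2 : η' * (2 * A + 2) ≤ η := by
    rw [← le_div_iff₀ (by positivity)]
    exact min_le_right _ _
  have hc : 0 < η' / (‖N‖ + 1) := by positivity
  have hlin := (estimating_isLittleO (D := D) (θ₀ := θ₀) (γ := γ) (w := w)).def hc
  rw [nhds_prod_eq] at hlin
  -- `P` restricts the data and `Q` the parameter. For data near the limit every minimizer lies in a
  -- ball inside `Q ∩ Θ`, so `Q` needs no separate assumption.
  obtain ⟨P, hP, Q, hQ, hPQ⟩ := eventually_prod_iff.1 hlin
  obtain ⟨ε, hε, hball⟩ := Metric.nhds_basis_closedBall.mem_iff.1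
    (inter_mem hQ (mem_interior_iff_mem_nhds.1 hθ₀))
  filter_upwards [hP, eventually_risk_lt hid hγ hw hε] with z hzP hfar
  refine ⟨exists_isMinOn_risk hε (hball.trans Set.inter_subset_right) hfar,
    fun θ hθ hmin => ?_⟩
  have hdist : dist θ θ₀ < ε := by
    by_contra! hcon
    exact absurd (hmin (interior_subset hθ₀)) (not_le.2 (hfar θ hθ hcon))
  have hloc : IsLocalMin (risk D γ z.1 z.2) θ := by
    refine hmin.isLocalMin (mem_of_superset
      (Metric.isOpen_ball.mem_nhds (Metric.mem_ball.2 hdist)) ?_)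
    exact Metric.ball_subset_closedBall.trans (hball.trans Set.inter_subset_right)
  have hb := hPQ hzP (hball (Metric.mem_closedBall.2 hdist.le)).1
  simp only [sum_score_eq_zero D hγ hloc, zero_sub, norm_neg] at hb
  set e := z.2 - failProb D θ₀ with he
  set h := θ - θ₀ with hh
  have hNJ (y : Param J) : N (Matrix.toEuclideanCLM (𝕜 := ℝ) (matJ D w γ θ₀) y) = y := by
    rw [hN, ← mul_apply_eq_comp, ← map_mul,
      Matrix.nonsing_inv_mul _ ((Matrix.isUnit_iff_isUnit_det _).1 hJ), map_one,
      one_apply_eq_self]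
  have hexp : h - ∑ i, (z.2 i - failProb D θ₀ i) • influence D w γ θ₀ i =
      N (Matrix.toEuclideanCLM (𝕜 := ℝ) (matJ D w γ θ₀) h -
        ∑ i, (w i * (z.2 i - failProb D θ₀ i)) • score D θ₀ i γ) := by
    rw [map_sub, hNJ, map_sum]
    congr 1
    refine Finset.sum_congr rfl fun i _ => ?_
    rw [influence, ← hN, map_smul, map_smul, smul_smul, mul_comm]
  have hmain : ‖h - ∑ i, (z.2 i - failProb D θ₀ i) • influence D w γ θ₀ i‖ ≤
      η' * (‖e‖ + ‖h‖) := by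
    rw [hexp]
    refine (N.le_opNorm _).trans ?_
    have h1 : ‖(e, h)‖ ≤ ‖e‖ + ‖h‖ :=
      max_le (le_add_of_nonneg_right (norm_nonneg _)) (le_add_of_nonneg_left (norm_nonneg _))
    have h2 : ‖N‖ / (‖N‖ + 1) ≤ 1 := by
      rw [div_le_one (by positivity)]
      linarith
    calc _ ≤ ‖N‖ * (η' / (‖N‖ + 1) * ‖(e, h)‖) :=
          mul_le_mul_of_nonneg_left hb (norm_nonneg _)
      _ = ‖N‖ / (‖N‖ + 1) * (η' * ‖(e, h)‖) := by ring
      _ ≤ 1 * (η' * ‖(e, h)‖) := mul_le_mul_of_nonneg_right h2 (by positivity)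
      _ ≤ _ := by
        rw [one_mul]
        exact mul_le_mul_of_nonneg_left h1 hη'0.le
  have hsum : ‖∑ i, (z.2 i - failProb D θ₀ i) • influence D w γ θ₀ i‖ ≤ A * ‖e‖ := by
    rw [hA, Finset.sum_mul]
    refine norm_sum_le_of_le _ fun i _ => ?_
    rw [norm_smul, mul_comm]
    exact mul_le_mul_of_nonneg_left (norm_le_pi_norm e i) (norm_nonneg _)
  have hh' : ‖h‖ ≤ A * ‖e‖ + η' * (‖e‖ + ‖h‖) := by
    have := norm_le_norm_add_norm_sub' h
      (∑ i, (z.2 i - failProb D θ₀ i) • influence D w γ θ₀ i)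
    linarith
  have hhe : ‖h‖ ≤ (2 * A + 1) * ‖e‖ := by nlinarith [norm_nonneg e, norm_nonneg h]
  calc _ ≤ η' * (‖e‖ + ‖h‖) := hmain
    _ ≤ η' * ((2 * A + 2) * ‖e‖) := mul_le_mul_of_nonneg_left (by linarith) hη'0.le
    _ = η' * (2 * A + 2) * ‖e‖ := by ring
    _ ≤ η * ‖e‖ := mul_le_mul_of_nonneg_right hη'2 (norm_nonneg _)

end OneShot

/-! ### Probabilistic inputs: failure probability and central limit theorem. -/

namespace OneShot

/-! ### Mass of the log-logistic law -/

lemma hasDerivAt_logLogisticCDF {α : ℝ} (β : ℝ) (hα : 0 < α) {t : ℝ} (ht : 0 < t) :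
    HasDerivAt (logLogisticCDF α β) (logLogisticPDF α β t) t := by
  have h1 : 0 < t ^ β + α ^ β := add_pos (Real.rpow_pos_of_pos ht β) (Real.rpow_pos_of_pos hα β)
  have hp : HasDerivAt (fun t : ℝ => t ^ β) (β * t ^ (β - 1)) t :=
    Real.hasDerivAt_rpow_const (Or.inl ht.ne')
  refine (hp.div (hp.add_const (α ^ β)) h1.ne').congr_deriv ?_
  rw [logLogisticPDF, if_pos ht]
  ring

lemma logLogisticPDF_nonneg {α β : ℝ} (hα : 0 < α) (hβ : 0 < β) (t : ℝ) :
    0 ≤ logLogisticPDF α β t := by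
  unfold logLogisticPDF
  split_ifs with h <;> positivity

lemma logLogisticMeasure_Iic {α β t : ℝ} (hα : 0 < α) (hβ : 0 < β) (ht : 0 < t) :
    logLogisticMeasure α β (Set.Iic t) = ENNReal.ofReal (logLogisticCDF α β t) := by
  have hcont : ContinuousOn (logLogisticCDF α β) (Set.Icc 0 t) := by
    refine ContinuousOn.div (Real.continuous_rpow_const hβ.le).continuousOn
      ((Real.continuous_rpow_const hβ.le).add continuous_const).continuousOn fun x hx => ?_
    have h1 : 0 ≤ x ^ β := Real.rpow_nonneg hx.1 β
    have h2 : 0 < α ^ β := Real.rpow_pos_of_pos hα β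
    positivity
  have hderiv (x : ℝ) (hx : x ∈ Set.Ioo 0 t) :
      HasDerivAt (logLogisticCDF α β) (logLogisticPDF α β x) x :=
    hasDerivAt_logLogisticCDF β hα hx.1
  -- The density may be unbounded near `0` when `β < 1`; integrability comes from its being the
  -- nonnegative derivative of a function continuous up to `0`.
  have hint : IntegrableOn (logLogisticPDF α β) (Set.Ioc 0 t) :=
    intervalIntegral.integrableOn_deriv_of_nonneg hcont hderiv
      fun x _ => logLogisticPDF_nonneg hα hβ x
  have hval : ∫ x in Set.Ioc 0 t, logLogisticPDF α β x = logLogisticCDF α β t := by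
    rw [← intervalIntegral.integral_of_le ht.le,
      intervalIntegral.integral_eq_sub_of_hasDerivAt_of_le ht.le hcont hderiv
        ((intervalIntegrable_iff_integrableOn_Ioc_of_le ht.le).2 hint)]
    simp [logLogisticCDF, Real.zero_rpow hβ.ne']
  have hzero : ∫⁻ x in Set.Iic 0, ENNReal.ofReal (logLogisticPDF α β x) = 0 := by
    rw [setLIntegral_congr_fun (g := 0) measurableSet_Iic]
    · simp
    · intro x hx
      simp [logLogisticPDF, not_lt.2 (Set.mem_Iic.1 hx)]
  rw [logLogisticMeasure, withDensity_apply _ measurableSet_Iic,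
    ← Set.Iic_union_Ioc_eq_Iic ht.le, lintegral_union measurableSet_Ioc
      (Set.Iic_disjoint_Ioc le_rfl), hzero, zero_add, ← hval,
    ofReal_integral_eq_lintegral_ofReal hint
      (Eventually.of_forall fun x => logLogisticPDF_nonneg hα hβ x)]

/-! ### A central limit theorem for several independent samples -/

section CLT

variable {Ω : Type*} [MeasurableSpace Ω] {P : Measure Ω}
  {E : Type*} [NormedAddCommGroup E] [InnerProductSpace ℝ E] [MeasurableSpace E] [BorelSpace E]
  {ι : Type*} [Fintype ι]

lemma charFun_map_smul_const {X : Ω → ℝ} (hX : AEMeasurable X P) (c t : E) :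
    charFun (P.map fun ω => X ω • c) t = charFun (P.map X) (inner ℝ c t) := by
  have h1 : Measurable fun x : ℝ => x • c := (continuous_id.smul continuous_const).measurable
  rw [show (fun ω => X ω • c) = (fun x : ℝ => x • c) ∘ X from rfl,
    ← AEMeasurable.map_map_of_aemeasurable h1.aemeasurable hX, charFun_apply, charFun_apply,
    integral_map h1.aemeasurable (by fun_prop)]
  refine integral_congr_ae (Eventually.of_forall fun x => ?_)
  simp [real_inner_smul_left, mul_comm]

variable [SecondCountableTopology E]

lemma charFun_map_sum_sum {V : ι × ℕ → Ω → E} (hV : iIndepFun V P)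
    (hVm : ∀ p, AEMeasurable (V p) P) (n : ι → ℕ) :
    charFun (P.map fun ω => ∑ i, ∑ k ∈ Finset.range (n i), V (i, k) ω) =
      ∏ i, charFun (P.map fun ω => ∑ k ∈ Finset.range (n i), V (i, k) ω) := by
  have hσ : iIndepFun (fun p : (_ : ι) × ℕ => V (p.1, p.2)) P :=
    hV.precomp (g := fun p : (_ : ι) × ℕ => (p.1, p.2)) (Equiv.sigmaEquivProd ι ℕ).injective
  have h := iIndepFun.charFun_map_fun_finsetSum_eq_prod
    (X := fun p : (_ : ι) × ℕ => V (p.1, p.2))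
    (s := Finset.univ.sigma fun i => Finset.range (n i)) (fun p _ => hVm _) (hσ.restrict _)
  simp only [Finset.sum_sigma, Finset.prod_sigma] at h
  rw [h]
  refine Finset.prod_congr rfl fun i _ => ?_
  exact (iIndepFun.charFun_map_fun_finsetSum_eq_prod (X := fun k => V (i, k))
    (fun k _ => hVm _) ((hV.precomp (Prod.mk_right_injective i)).restrict _)).symm

/-- Independence factors the characteristic function over the samples, so sizes growing at different
rates need only the scalar theorem, composed with each `n m i`. -/
lemma tendsto_charFun_sum_smul [IsProbabilityMeasure P] {Y : ι × ℕ → Ω → ℝ} (hY : iIndepFun Y P)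
    (hident : ∀ i k, IdentDistrib (Y (i, k)) (Y (i, 0)) P P) (hL2 : ∀ i, MemLp (Y (i, 0)) 2 P)
    {n : ℕ → ι → ℕ} (hn : ∀ i, Tendsto (fun m => n m i) atTop atTop) (c : ι → E) (t : E) :
    Tendsto (fun m => charFun (P.map fun ω => ∑ i, ((√(n m i : ℝ))⁻¹ *
        (∑ k ∈ Finset.range (n m i), Y (i, k) ω - n m i * P[Y (i, 0)])) • c i) t)
      atTop (𝓝 (∏ i, Complex.exp (-(Var[Y (i, 0); P] * inner ℝ (c i) t ^ 2 / 2 : ℝ)))) := by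
  have hYm (p : ι × ℕ) : AEMeasurable (Y p) P := (hident p.1 p.2).aemeasurable_fst
  have hsplit (m : ℕ) : charFun (P.map fun ω => ∑ i, ((√(n m i : ℝ))⁻¹ *
        (∑ k ∈ Finset.range (n m i), Y (i, k) ω - n m i * P[Y (i, 0)])) • c i) t =
      ∏ i, charFun (P.map fun ω => (√(n m i : ℝ))⁻¹ *
        (∑ k ∈ Finset.range (n m i), Y (i, k) ω - n m i * P[Y (i, 0)])) (inner ℝ (c i) t) := by
    -- Centering and scaling are distributed over the individual summands, so that independence of
    -- the `V p` applies.
    let V : ι × ℕ → Ω → E := fun p ω =>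
      ((√(n m p.1 : ℝ))⁻¹ * (Y p ω - P[Y (p.1, 0)])) • c p.1
    have hg (p : ι × ℕ) :
        Measurable fun y : ℝ => ((√(n m p.1 : ℝ))⁻¹ * (y - P[Y (p.1, 0)])) • c p.1 :=
      Continuous.measurable (by fun_prop)
    have hV : iIndepFun V P := hY.comp _ hg
    have hVm (p : ι × ℕ) : AEMeasurable (V p) P := (hg p).comp_aemeasurable (hYm p)
    have hsum (i : ι) (ω : Ω) : ∑ k ∈ Finset.range (n m i), V (i, k) ω = ((√(n m i : ℝ))⁻¹ *
        (∑ k ∈ Finset.range (n m i), Y (i, k) ω - n m i * P[Y (i, 0)])) • c i := by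
      simp only [V, ← Finset.sum_smul, ← Finset.mul_sum, Finset.sum_sub_distrib,
        Finset.sum_const, Finset.card_range, nsmul_eq_mul]
    have h := charFun_map_sum_sum hV hVm (n m)
    simp only [hsum] at h
    rw [h, Finset.prod_apply]
    refine Finset.prod_congr rfl fun i _ => charFun_map_smul_const ?_ _ _
    exact ((Finset.aemeasurable_fun_sum _ fun k _ => hYm (i, k)).sub_const _).const_mul _
  simp only [hsplit]
  refine tendsto_finsetProd _ fun i _ => ?_
  have hclt := tendstoInDistribution_inv_sqrt_mul_sum_sub (P := P) (X := fun k => Y (i, k))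
    (Y := id) (P' := gaussianReal 0 Var[Y (i, 0); P].toNNReal) HasLaw.id (hL2 i)
    (hY.precomp (Prod.mk_right_injective i)) (hident i)
  have h := (ProbabilityMeasure.tendsto_iff_tendsto_charFun.1 hclt.tendsto
    (inner ℝ (c i) t)).comp (hn i)
  -- As `Tendsto` is an inequality of filters, what remains is to compare the neighbourhood filters
  -- of the two limits.
  refine (h.congr fun m => rfl).trans ?_
  simp only [ProbabilityMeasure.coe_mk, Measure.map_id, charFun_gaussianReal]
  rw [Real.coe_toNNReal _ (variance_nonneg _ _)]
  simp

end CLT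

end OneShot

/-! ### Tightness, covariance identity and remainder. -/

namespace OneShot

/-- Chebyshev's inequality; the bound is free of `n`, which gives tightness of the normalized
counts. -/
lemma measure_le_abs_normalized_sum_le {Ω : Type*} [MeasurableSpace Ω] {P : Measure Ω}
    [IsProbabilityMeasure P] {Y : ℕ → Ω → ℝ} (hY : iIndepFun Y P)
    (hident : ∀ k, IdentDistrib (Y k) (Y 0) P P) (hL2 : MemLp (Y 0) 2 P) {n : ℕ} (hn : 0 < n)
    {c : ℝ} (hc : 0 < c) :
    P {ω | c ≤ |(√(n : ℝ))⁻¹ * (∑ k ∈ Finset.range n, Y k ω - n * P[Y 0])|} ≤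
      ENNReal.ofReal (Var[Y 0; P] / c ^ 2) := by
  have hL (k : ℕ) : MemLp (Y k) 2 P := (hident k).symm.memLp_iff.1 hL2
  have hn' : (0 : ℝ) < n := by exact_mod_cast hn
  have hs : 0 < √(n : ℝ) := Real.sqrt_pos.2 hn'
  have hmean : ∫ ω, (∑ k ∈ Finset.range n, Y k) ω ∂P = (n : ℝ) * P[Y 0] := by
    simp only [Finset.sum_apply]
    rw [integral_finsetSum _ fun k _ => (hL k).integrable one_le_two]
    simp [fun k => (hident k).integral_eq]
  have hvar : Var[∑ k ∈ Finset.range n, Y k; P] = n * Var[Y 0; P] := by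
    rw [IndepFun.variance_sum (fun k _ => hL k) fun i _ j _ hij => hY.indepFun hij]
    simp [fun k => (hident k).variance_eq]
  have h := meas_ge_le_variance_div_sq (memLp_finsetSum' (Finset.range n) fun k _ => hL k)
    (mul_pos hs hc)
  rw [hmean, hvar, mul_pow, Real.sq_sqrt hn'.le, mul_div_mul_left _ _ hn'.ne'] at h
  refine (measure_mono fun ω hω => ?_).trans h
  simp only [Set.mem_ofPred_eq, abs_mul, abs_inv, abs_of_pos hs] at hω
  simp only [Set.mem_ofPred_eq, Finset.sum_apply]
  rwa [le_inv_mul_iff₀ hs] at hω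

variable {I J : ℕ} (D : Design I J)

/-! ### Failure indicators -/

/-- Indicator of a failure before the inspection time, as a function of the lifetime. -/
noncomputable def failInd (i : Fin I) : ℝ → ℝ := (Set.Iic (D.τ i)).indicator 1

lemma measurable_failInd (i : Fin I) : Measurable (failInd D i) :=
  measurable_one.indicator measurableSet_Iic

lemma failures_eq_sum (i : Fin I) (K : ℕ) (t : ℕ → ℝ) :
    (failures D i K t : ℝ) = ∑ k ∈ Finset.range K, failInd D i (t k) := by
  simp [failures, failInd, Set.indicator_apply, Finset.sum_boole]

section Law

variable {D} {Ω : Type*} [MeasurableSpace Ω] {P : Measure Ω}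
  {θ₀ : Param J} {i : Fin I} {X : Ω → ℝ}

lemma integral_failInd
    (hX : HasLaw X (logLogisticMeasure (scale D θ₀ i) (shape D θ₀ i)) P) :
    P[fun ω => failInd D i (X ω)] = failProb D θ₀ i := by
  have h := integral_map hX.aemeasurable
    ((measurable_failInd D i).aestronglyMeasurable (μ := P.map X))
  rw [← h, hX.map_eq, failInd, integral_indicator_one measurableSet_Iic, measureReal_def,
    logLogisticMeasure_Iic (scale_pos D θ₀ i) (shape_pos D θ₀ i) (D.τ_pos i)]
  exact ENNReal.toReal_ofReal (failProb_pos D θ₀ i).le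

lemma memLp_failInd [IsProbabilityMeasure P] (hX : AEMeasurable X P) : MemLp (fun ω => failInd D i (X ω)) 2 P := by
  refine MemLp.of_bound ((measurable_failInd D i).comp_aemeasurable hX).aestronglyMeasurable 1
    (Eventually.of_forall fun ω => ?_)
  simp only [failInd, Set.indicator_apply]
  split_ifs <;> simp

lemma variance_failInd [IsProbabilityMeasure P]
    (hX : HasLaw X (logLogisticMeasure (scale D θ₀ i) (shape D θ₀ i)) P) :
    Var[fun ω => failInd D i (X ω); P] = failProb D θ₀ i * relProb D θ₀ i := by
  have hsq : (fun ω => failInd D i (X ω)) ^ 2 = fun ω => failInd D i (X ω) := by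
    funext ω
    simp only [Pi.pow_apply, failInd, Set.indicator_apply]
    split_ifs <;> simp
  rw [variance_eq_sub (memLp_failInd hX.aemeasurable), hsq, integral_failInd hX, relProb_eq]
  ring

end Law

/-! ### The asymptotic covariance -/

variable (w : Fin I → ℝ) (γ : ℝ) (θ : Param J)

lemma isHermitian_matJ : (matJ D w γ θ).IsHermitian := by
  ext a b
  simp only [matJ, matM_eq_vecMulVec, Matrix.conjTranspose_apply, Matrix.sum_apply,
    Matrix.smul_apply, Matrix.vecMulVec_apply, star_trivial, smul_eq_mul]
  exact Finset.sum_congr rfl fun i _ => by ring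

variable {w}

lemma posSemidef_matK (hw : ∀ i, 0 < w i) : (matK D w γ θ).PosSemidef := by
  refine Matrix.posSemidef_sum _ fun i _ => ?_
  have hF := failProb_pos D θ i
  have hR : 0 < relProb D θ i := by
    rw [relProb_eq]
    linarith [failProb_lt_one D θ i]
  rw [matM_eq_vecMulVec]
  have h := Matrix.posSemidef_vecMulVec_self_star (logitGrad D θ i)
  rw [star_trivial] at h
  exact h.smul (by have := hw i; positivity)

lemma posSemidef_asympCov (hw : ∀ i, 0 < w i) : (asympCov D w γ θ).PosSemidef := by
  have h := (posSemidef_matK D γ θ hw).mul_mul_conjTranspose_same (matJ D w γ θ)⁻¹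
  rwa [(isHermitian_matJ D w γ θ).inv.eq] at h

/-- The right side is the variance supplied by the central limit theorem. Symmetry of `J⁻¹` moves it
onto `t`; the Bernoulli variance `F R` and the squared factor `F R` of the gradient produce `F ^ 3 *
R ^ 3`. -/
lemma dotProduct_asympCov (hw : ∀ i, 0 < w i) (t : Param J) :
    t.ofLp ⬝ᵥ (asympCov D w γ θ).mulVec t.ofLp =
      ∑ i, failProb D θ i * relProb D θ i *
        inner ℝ ((√(w i))⁻¹ • influence D w γ θ i) t ^ 2 := by
  set N := (matJ D w γ θ)⁻¹ with hN
  have hNT : N.transpose = N := by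
    have := (isHermitian_matJ D w γ θ).inv.eq
    rwa [Matrix.conjTranspose_eq_transpose_of_trivial] at this
  have hinner (i : Fin I) : inner ℝ ((√(w i))⁻¹ • influence D w γ θ i) t =
      (√(w i))⁻¹ * (w i * (dpdWeight γ (failProb D θ i) *
        (failProb D θ i * relProb D θ i * (logitGrad D θ i ⬝ᵥ N.mulVec t.ofLp)))) := by
    have h1 : t.ofLp ⬝ᵥ N.mulVec (logitGrad D θ i) = logitGrad D θ i ⬝ᵥ N.mulVec t.ofLp := by
      rw [Matrix.dotProduct_mulVec, ← Matrix.mulVec_transpose, hNT, dotProduct_comm]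
    have h2 : inner ℝ (WithLp.toLp 2 (N.mulVec (logitGrad D θ i))) t =
        logitGrad D θ i ⬝ᵥ N.mulVec t.ofLp := by
      rw [← h1, EuclideanSpace.inner_eq_star_dotProduct, star_trivial]
    simp only [influence, score, failGrad, map_smul, real_inner_smul_left, ← hN,
      Matrix.toEuclideanCLM_toLp, h2]
  have hquad : t.ofLp ⬝ᵥ (asympCov D w γ θ).mulVec t.ofLp =
      N.mulVec t.ofLp ⬝ᵥ (matK D w γ θ).mulVec (N.mulVec t.ofLp) := by
    rw [asympCov, ← hN, ← Matrix.mulVec_mulVec, ← Matrix.mulVec_mulVec, Matrix.dotProduct_mulVec,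
      ← Matrix.mulVec_transpose, hNT]
  rw [hquad]
  simp only [matK, Matrix.sum_mulVec, Matrix.smul_mulVec, matM_eq_vecMulVec,
    Matrix.vecMulVec_mulVec, dotProduct_sum, dotProduct_smul, hinner]
  refine Finset.sum_congr rfl fun i _ => ?_
  have hwi : (√(w i))⁻¹ ^ 2 * w i = 1 := by
    rw [inv_pow, Real.sq_sqrt (hw i).le, inv_mul_cancel₀ (hw i).ne']
  simp only [smul_eq_mul, MulOpposite.smul_eq_mul_unop, MulOpposite.unop_op, dpdWeight,
    ← relProb_eq, dotProduct_comm (N.mulVec t.ofLp) (logitGrad D θ i)]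
  linear_combination (-(w i * (failProb D θ i ^ (γ - 1) + relProb D θ i ^ (γ - 1)) ^ 2 *
    failProb D θ i ^ 3 * relProb D θ i ^ 3 *
    (logitGrad D θ i ⬝ᵥ N.mulVec t.ofLp) ^ 2)) * hwi

/-! ### The remainder -/

variable {D γ} {Θ : Set (Param J)} {θ₀ : Param J} {K : ℕ → Fin I → ℕ}

lemma tendsto_sampleSize (hK : Tendsto (fun m => ∑ i, K m i) atTop atTop)
    (hKw : ∀ i, Tendsto (fun m => (K m i : ℝ) / (∑ l, (K m l : ℝ))) atTop (𝓝 (w i)))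
    (hw : ∀ i, 0 < w i) (i : Fin I) : Tendsto (fun m => K m i) atTop atTop := by
  have hK' : Tendsto (fun m => ∑ l, (K m l : ℝ)) atTop atTop := by
    have := tendsto_natCast_atTop_atTop (R := ℝ) |>.comp hK
    simpa [Function.comp_def] using this
  rw [← tendsto_natCast_atTop_iff (R := ℝ)]
  refine (Tendsto.pos_mul_atTop (hw i) (hKw i) hK').congr' ?_
  filter_upwards [hK'.eventually_gt_atTop 0] with m hm
  exact div_mul_cancel₀ _ hm.ne'

/-- As long as the normalized failure counts stay bounded, the normalized estimation error is
asymptotically linear in them. -/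
lemma eventually_norm_remainder_lt (hθ₀ : θ₀ ∈ interior Θ) (hid : IdentifiableAt D Θ θ₀)
    (hγ : 0 ≤ γ) (hK : Tendsto (fun m => ∑ i, K m i) atTop atTop)
    (hKw : ∀ i, Tendsto (fun m => (K m i : ℝ) / (∑ l, (K m l : ℝ))) atTop (𝓝 (w i)))
    (hw : ∀ i, 0 < w i) (hJ : IsUnit (matJ D w γ θ₀)) {M ε : ℝ} (hM : 0 < M) (hε : 0 < ε) :
    ∀ᶠ m in atTop, ∀ (n : Fin I → ℕ) (θ : Param J),
      ((∃ η, IsWMDPDE D Θ γ (K m) n η) → IsWMDPDE D Θ γ (K m) n θ) →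
      (∀ i, |(√(K m i : ℝ))⁻¹ * (n i - K m i * failProb D θ₀ i)| < M) →
      ‖√(∑ i, (K m i : ℝ)) • (θ - θ₀) - ∑ i, ((√(K m i : ℝ))⁻¹ *
        (n i - K m i * failProb D θ₀ i)) • ((√(w i))⁻¹ • influence D w γ θ₀ i)‖ < ε := by
  set W := ∑ i, (√(w i))⁻¹ with hW
  have hW0 : 0 ≤ W := Finset.sum_nonneg fun i _ => by positivity
  -- Chosen so that the limit `M * (η * W)` of the bound below is less than `ε`.
  set η := ε / (2 * M * (W + 1)) with hη
  have hη0 : 0 < η := by positivity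
  have hexp := eventually_isMinOn_expansion hθ₀ hid hγ hw hJ hη0
  rw [nhds_prod_eq] at hexp
  obtain ⟨A, hA, B, hB, hAB⟩ := eventually_prod_iff.1 hexp
  obtain ⟨r, hr, hball⟩ := Metric.mem_nhds_iff.1 hB
  have hKi := tendsto_sampleSize hK hKw hw
  have hu := (tendsto_pi_nhds.2 hKw).eventually hA
  have hrate : ∀ᶠ m in atTop, ∀ i, M / √(K m i : ℝ) < r := eventually_all.2 fun i =>
    (tendsto_const_nhds.div_atTop (Real.tendsto_sqrt_atTop.comp
      (tendsto_natCast_atTop_atTop.comp (hKi i)))).eventually_lt_const hr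
  have hKpos : ∀ᶠ m in atTop, ∀ i, 0 < K m i :=
    eventually_all.2 fun i => (hKi i).eventually_gt_atTop 0
  have hρ (i : Fin I) : Tendsto (fun m => (√((K m i : ℝ) / ∑ l, (K m l : ℝ)))⁻¹) atTop
      (𝓝 (√(w i))⁻¹) :=
    ((Real.continuous_sqrt.tendsto _).comp (hKw i)).inv₀ (Real.sqrt_pos.2 (hw i)).ne'
  -- The first sum bounds the nonlinear error, the second the cost of replacing `K_i / K` by `w_i`
  -- in the scaling.
  have hbound : ∀ᶠ m in atTop, M * (η * ∑ i, (√((K m i : ℝ) / ∑ l, (K m l : ℝ)))⁻¹ +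
      ∑ i, |(√((K m i : ℝ) / ∑ l, (K m l : ℝ)))⁻¹ - (√(w i))⁻¹| * ‖influence D w γ θ₀ i‖)
        < ε := by
    have h1 : Tendsto (fun m => M * (η * ∑ i, (√((K m i : ℝ) / ∑ l, (K m l : ℝ)))⁻¹ +
        ∑ i, |(√((K m i : ℝ) / ∑ l, (K m l : ℝ)))⁻¹ - (√(w i))⁻¹| *
          ‖influence D w γ θ₀ i‖)) atTop (𝓝 (M * (η * W + ∑ i, |(√(w i))⁻¹ - (√(w i))⁻¹| *
          ‖influence D w γ θ₀ i‖))) :=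
      (((tendsto_finsetSum _ fun i _ => hρ i).const_mul η).add (tendsto_finsetSum _ fun i _ =>
        ((hρ i).sub_const _).abs.mul_const _)).const_mul M
    refine h1.eventually_lt_const ?_
    simp only [sub_self, abs_zero, zero_mul, Finset.sum_const_zero, add_zero]
    rw [hη, ← mul_assoc, mul_div_assoc', div_mul_eq_mul_div, div_lt_iff₀ (by positivity)]
    nlinarith [mul_pos hM hε, mul_nonneg (mul_pos hM hε).le hW0]
  filter_upwards [hu, hrate, hKpos, hbound] with m hu hrate hKpos hbound n θ hθ hM'
  set s : Fin I → ℝ := fun i => (√(K m i : ℝ))⁻¹ * (n i - K m i * failProb D θ₀ i) with hs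
  set S := ∑ l, (K m l : ℝ) with hS
  set ρ : Fin I → ℝ := fun i => (√((K m i : ℝ) / S))⁻¹ with hρ'
  set e : Fin I → ℝ := (fun i => (n i : ℝ) / K m i) - failProb D θ₀ with he
  have hKr (i : Fin I) : (0 : ℝ) < K m i := by exact_mod_cast hKpos i
  have hei (i : Fin I) : e i = (√(K m i : ℝ))⁻¹ * s i := by
    simp only [he, hs, Pi.sub_apply]
    rw [← mul_assoc, ← mul_inv, Real.mul_self_sqrt (hKr i).le]
    have := (hKr i).ne'
    field_simp
  have hSe (i : Fin I) : √S * e i = ρ i * s i := by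
    rw [hei, hρ']
    simp only
    rw [Real.sqrt_div (hKr i).le, inv_div]
    ring
  have hesmall : ∀ i, |e i| < r := fun i => by
    rw [hei, abs_mul, abs_inv, abs_of_nonneg (Real.sqrt_nonneg _)]
    refine lt_of_le_of_lt ?_ (hrate i)
    rw [div_eq_inv_mul]
    exact mul_le_mul_of_nonneg_left (hM' i).le (by positivity)
  have hp : (fun i => (n i : ℝ) / K m i) ∈ Metric.ball (failProb D θ₀) r := by
    rw [Metric.mem_ball, dist_pi_lt_iff hr]
    intro i
    rw [Real.dist_eq]
    exact hesmall i
  obtain ⟨⟨θ', hθ', hmin'⟩, hall⟩ := hAB hu (hball hp)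
  simp only [IsWMDPDE, wdpd_eq_risk] at hθ
  obtain ⟨hθΘ, hθmin⟩ := hθ ⟨θ', hθ', hmin'⟩
  have hlin : ‖θ - θ₀ - ∑ i, e i • influence D w γ θ₀ i‖ ≤ η * ‖e‖ := hall θ hθΘ hθmin
  have hnorm : ‖e‖ ≤ ∑ i, |e i| := by
    refine (pi_norm_le_iff_of_nonneg (Finset.sum_nonneg fun i _ => abs_nonneg _)).2 fun i => ?_
    exact Finset.single_le_sum (f := fun i => |e i|) (fun i _ => abs_nonneg _)
      (Finset.mem_univ i)
  have hρ0 (i : Fin I) : 0 ≤ ρ i := by positivity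
  have h1 : ‖√S • (θ - θ₀) - ∑ i, (ρ i * s i) • influence D w γ θ₀ i‖ ≤ M * (η * ∑ i, ρ i) := by
    have hfac : √S • (θ - θ₀) - ∑ i, (ρ i * s i) • influence D w γ θ₀ i =
        √S • (θ - θ₀ - ∑ i, e i • influence D w γ θ₀ i) := by
      rw [smul_sub (√S) (θ - θ₀), Finset.smul_sum]
      simp only [smul_smul, hSe]
    rw [hfac, norm_smul, Real.norm_of_nonneg (Real.sqrt_nonneg _)]
    calc √S * ‖θ - θ₀ - ∑ i, e i • influence D w γ θ₀ i‖ ≤ √S * (η * ∑ i, |e i|) :=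
          mul_le_mul_of_nonneg_left (hlin.trans (mul_le_mul_of_nonneg_left hnorm hη0.le))
            (Real.sqrt_nonneg _)
      _ = η * ∑ i, |√S * e i| := by
          simp only [abs_mul, abs_of_nonneg (Real.sqrt_nonneg S), ← Finset.mul_sum]
          ring
      _ ≤ η * ∑ i, ρ i * M := by
          refine mul_le_mul_of_nonneg_left (Finset.sum_le_sum fun i _ => ?_) hη0.le
          rw [hSe, abs_mul, abs_of_nonneg (hρ0 i)]
          exact mul_le_mul_of_nonneg_left (hM' i).le (hρ0 i)
      _ = M * (η * ∑ i, ρ i) := by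
          rw [← Finset.sum_mul]
          ring
  have h2 : ‖∑ i, (ρ i * s i) • influence D w γ θ₀ i -
      ∑ i, s i • ((√(w i))⁻¹ • influence D w γ θ₀ i)‖ ≤
      M * ∑ i, |ρ i - (√(w i))⁻¹| * ‖influence D w γ θ₀ i‖ := by
    rw [← Finset.sum_sub_distrib, Finset.mul_sum]
    refine norm_sum_le_of_le _ fun i _ => ?_
    rw [smul_smul, ← sub_smul, norm_smul, Real.norm_eq_abs,
      show ρ i * s i - s i * (√(w i))⁻¹ = s i * (ρ i - (√(w i))⁻¹) by ring, abs_mul, mul_assoc]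
    exact mul_le_mul_of_nonneg_right (hM' i).le (by positivity)
  refine lt_of_le_of_lt ((norm_sub_le_norm_sub_add_norm_sub _
    (∑ i, (ρ i * s i) • influence D w γ θ₀ i) _).trans (add_le_add h1 h2)) ?_
  rw [← mul_add]
  exact hbound

end OneShot

/-! ### Assembly by Slutsky's argument. -/

open OneShot in
/-- Asymptotic normality of the weighted minimum density power divergence estimator. The sample
sizes `K m i` of stage `m` have total tending to infinity and proportions tending to `w i > 0`; the
lifetime of the `k`-th device under condition `i` is `T i k`. The estimator `est m` is any random
vector that minimizes the weighted density power divergence over `Θ` whenever a minimizer exists. -/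
theorem mainTheorem1 {I J : ℕ} (D : OneShot.Design I J)
    (Θ : Set (OneShot.Param J)) (θ₀ : OneShot.Param J) (hθ₀ : θ₀ ∈ interior Θ)
    (hid : OneShot.IdentifiableAt D Θ θ₀)
    (γ : ℝ) (hγ : 0 ≤ γ)
    (K : ℕ → Fin I → ℕ) (w : Fin I → ℝ)
    (hK : Tendsto (fun m => ∑ i, K m i) atTop atTop)
    (hKw : ∀ i, Tendsto (fun m => (K m i : ℝ) / (∑ l, (K m l : ℝ))) atTop (𝓝 (w i)))
    (hw : ∀ i, 0 < w i)
    (hJ : IsUnit (OneShot.matJ D w γ θ₀))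
    {Ω : Type*} [MeasurableSpace Ω] (P : Measure Ω) [IsProbabilityMeasure P]
    (T : Fin I → ℕ → Ω → ℝ)
    (hT_law : ∀ i k, HasLaw (T i k)
      (OneShot.logLogisticMeasure (OneShot.scale D θ₀ i) (OneShot.shape D θ₀ i)) P)
    (hT_indep : iIndepFun (fun p : Fin I × ℕ => T p.1 p.2) P)
    (est : ℕ → Ω → OneShot.Param J) (hest_meas : ∀ m, AEMeasurable (est m) P)
    (hest : ∀ m, ∀ᵐ ω ∂P,
      (∃ θ, OneShot.IsWMDPDE D Θ γ (K m)
        (fun i => OneShot.failures D i (K m i) (fun k => T i k ω)) θ) →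
      OneShot.IsWMDPDE D Θ γ (K m)
        (fun i => OneShot.failures D i (K m i) (fun k => T i k ω)) (est m ω)) :
    (OneShot.asympCov D w γ θ₀).PosSemidef ∧
    TendstoInDistribution
      (fun m ω => Real.sqrt (∑ i, (K m i : ℝ)) • (est m ω - θ₀)) atTop
      (id : OneShot.Param J → OneShot.Param J) (fun _ => P)
      (multivariateGaussian 0 (OneShot.asympCov D w γ θ₀)) := by
  refine ⟨posSemidef_asympCov D γ θ₀ hw, ?_⟩
  set Y : Fin I × ℕ → Ω → ℝ := fun p ω => failInd D p.1 (T p.1 p.2 ω) with hY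
  have hTm (i : Fin I) (k : ℕ) : AEMeasurable (T i k) P := (hT_law i k).aemeasurable
  have hYm (p : Fin I × ℕ) : AEMeasurable (Y p) P :=
    (measurable_failInd D p.1).comp_aemeasurable (hTm p.1 p.2)
  have hYindep : iIndepFun Y P := hT_indep.comp _ fun p => measurable_failInd D p.1
  have hYident (i : Fin I) (k : ℕ) : IdentDistrib (Y (i, k)) (Y (i, 0)) P P :=
    IdentDistrib.comp ⟨hTm i k, hTm i 0, (hT_law i k).map_eq.trans (hT_law i 0).map_eq.symm⟩
      (measurable_failInd D i)
  have hYL (i : Fin I) : MemLp (Y (i, 0)) 2 P := memLp_failInd (hTm i 0)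
  have hYmean (i : Fin I) : P[Y (i, 0)] = failProb D θ₀ i := integral_failInd (hT_law i 0)
  have hYvar (i : Fin I) : Var[Y (i, 0); P] = failProb D θ₀ i * relProb D θ₀ i :=
    variance_failInd (hT_law i 0)
  have hKi := tendsto_sampleSize hK hKw hw
  set c : Fin I → Param J := fun i => (√(w i))⁻¹ • influence D w γ θ₀ i with hc
  set S : ℕ → Fin I → Ω → ℝ := fun m i ω => (√(K m i : ℝ))⁻¹ *
    (∑ k ∈ Finset.range (K m i), Y (i, k) ω - K m i * P[Y (i, 0)]) with hS
  have hSm (m : ℕ) (i : Fin I) : AEMeasurable (S m i) P :=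
    ((Finset.aemeasurable_fun_sum _ fun k _ => hYm (i, k)).sub_const _).const_mul _
  have hLm (m : ℕ) : AEMeasurable (fun ω => ∑ i, S m i ω • c i) P :=
    Finset.aemeasurable_fun_sum _ fun i _ => (hSm m i).smul_const _
  have hEm (m : ℕ) : AEMeasurable
      (fun ω => Real.sqrt (∑ i, (K m i : ℝ)) • (est m ω - θ₀)) P :=
    ((hest_meas m).sub_const θ₀).const_smul (Real.sqrt (∑ i, (K m i : ℝ)))
  have hlinear : TendstoInDistribution (fun m ω => ∑ i, S m i ω • c i) atTop
      (id : Param J → Param J) (fun _ => P) (multivariateGaussian 0 (asympCov D w γ θ₀)) := by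
    refine ⟨hLm, aemeasurable_id, ProbabilityMeasure.tendsto_iff_tendsto_charFun.2 fun t => ?_⟩
    have h := tendsto_charFun_sum_smul hYindep hYident hYL hKi c t
    simp only [ProbabilityMeasure.coe_mk, Measure.map_id]
    rw [charFun_multivariateGaussian (posSemidef_asympCov D γ θ₀ hw),
      dotProduct_asympCov D γ θ₀ hw]
    convert h using 2
    rw [← Complex.exp_sum]
    simp only [hYvar, hc, inner_zero_right, Complex.ofReal_zero, zero_mul, zero_sub,
      Complex.ofReal_sum, Complex.ofReal_div, Finset.sum_neg_distrib,
      Finset.sum_div, Complex.ofReal_ofNat]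
  refine tendstoInDistribution_of_tendstoInMeasure_sub _ _ hlinear ?_ hEm
  rw [tendstoInMeasure_iff_norm]
  intro ε hε
  rw [ENNReal.tendsto_nhds_zero]
  intro δ hδ
  have htail : Tendsto (fun M : ℝ => ∑ i, ENNReal.ofReal (Var[Y (i, 0); P] / M ^ 2)) atTop
      (𝓝 0) := by
    have h (i : Fin I) : Tendsto (fun M : ℝ => ENNReal.ofReal (Var[Y (i, 0); P] / M ^ 2)) atTop
        (𝓝 0) := by
      rw [← ENNReal.ofReal_zero]
      exact ENNReal.tendsto_ofReal
        (tendsto_const_nhds.div_atTop (tendsto_pow_atTop two_ne_zero))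
    simpa using tendsto_finsetSum Finset.univ fun i _ => h i
  -- `M` is fixed before `m`: the remainder estimate holds eventually for each fixed `M`, and the
  -- Chebyshev tail is at most `δ` uniformly in `m`.
  obtain ⟨M, hMδ, hM⟩ :=
    (((ENNReal.tendsto_nhds_zero.1 htail) δ hδ).and (eventually_gt_atTop 0)).exists
  have hKpos : ∀ᶠ m in atTop, ∀ i, 0 < K m i :=
    eventually_all.2 fun i => (hKi i).eventually_gt_atTop 0
  filter_upwards [eventually_norm_remainder_lt hθ₀ hid hγ hK hKw hw hJ hM hε, hKpos]
    with m hm hKm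
  -- Where all counts are below `M` a minimizer exists, so the arbitrary values of the estimator
  -- matter only inside the union. The inclusion is almost sure because the estimator's defining
  -- property is.
  have hsub : {ω | ε ≤ ‖((fun m ω => Real.sqrt (∑ i, (K m i : ℝ)) • (est m ω - θ₀)) -
      fun m ω => ∑ i, S m i ω • c i) m ω - (0 : ℕ → Ω → Param J) m ω‖} ≤ᵐ[P]
      ⋃ i, {ω | M ≤ |S m i ω|} := by
    filter_upwards [hest m] with ω hω hfar
    by_contra hnot
    have hsmall (i : Fin I) : |S m i ω| < M := by
      by_contra! hge
      exact hnot (Set.mem_iUnion.2 ⟨i, hge⟩)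
    have hSeq (i : Fin I) : (√(K m i : ℝ))⁻¹ * ((failures D i (K m i) fun k => T i k ω : ℕ) -
        K m i * failProb D θ₀ i) = S m i ω := by
      rw [failures_eq_sum, ← hYmean]
    have h := hm _ _ hω (fun i => by rw [hSeq]; exact hsmall i)
    simp only [hSeq] at h
    refine absurd h (not_lt.2 ?_)
    change ε ≤ ‖_ - 0‖ at hfar
    rwa [sub_zero] at hfar
  calc _ ≤ P (⋃ i, {ω | M ≤ |S m i ω|}) := measure_mono_ae hsub
    _ ≤ ∑ i, P {ω | M ≤ |S m i ω|} := measure_iUnion_fintype_le _ _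
    _ ≤ ∑ i, ENNReal.ofReal (Var[Y (i, 0); P] / M ^ 2) :=
        Finset.sum_le_sum fun i _ => measure_le_abs_normalized_sum_le
          (hYindep.precomp (Prod.mk_right_injective i)) (hYident i) (hYL i) (hKm i) hM
    _ ≤ δ := hMδ
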